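/- For each $n\ge1$ let $\eta_1,\dots,\eta_{n+1}$ be independent Bernoulli variables with $P(\eta_i=1)=p=1-P(\eta_i=0)$, where $p=p_n$, and let $S_\xi=\sum_{i=1}^n\eta_i\eta_{i+1}$ be the 2-runs statistic. Put $$\bar p=\frac{np^3(2-3p)-2p^3(1-p)}{np^2+np^3(2-3p)-2p^3(1-p)},\qquad \bar q=1-\bar p,\qquad r=\frac{n^2p^4}{np^3(2-3p)-2p^3(1-p)},$$ and $$\mathrm{NB}(r,\bar q)\{j\}=\frac{\Gamma(r+j)}{j!\,\Gamma(r)}\,\bar q^{\,r}\,\bar p^{\,j}$$ (for these parameters the negative binomial distribution $\mathrm{NB}(r,\bar q)$ has the same mean and variance as $S_\xi$). Let $x=x_n$ be non-negative integers. If $p\to0$, $np\to\infty$ and $|x-np^2|=o\big(\min(np^2,\,n^{2/3}p^{2/3})\big)$ as $n\to\infty$, then $$\frac{P(S_\xi=x)}{\mathrm{NB}(r,\bar q)\{x\}}\to1\qquad(n\to\infty).$$ -/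

import Mathlib

open MeasureTheory ProbabilityTheory Filter Topology Asymptotics

/-- `η 0, …, η m` (any finite or infinite family) are independent, identically distributed Bernoulli
random variables with success probability `p`, on the measure space `(Ω, μ)`. -/
structure IsIIDBernoulli {ι Ω : Type*} [MeasurableSpace Ω] (μ : Measure Ω) (η : ι → Ω → ℕ)
    (p : ℝ) : Prop where
  measurable : ∀ i, Measurable (η i)
  indep : iIndepFun η μ
  prob_one : ∀ i, μ.real {ω | η i ω = 1} = p
  prob_zero : ∀ i, μ.real {ω | η i ω = 0} = 1 - p

/-- The 2-runs statistic `S = ∑ η_i η_{i+1}` (`n` summands) of the `n + 1` variables `η`. -/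
def twoRuns {Ω : Type*} {n : ℕ} (η : Fin (n + 1) → Ω → ℕ) (ω : Ω) : ℕ :=
  ∑ i : Fin n, η i.castSucc ω * η i.succ ω

/-- The probability `Γ(r + j) / (j! Γ(r)) * q ^ r * (1 - q) ^ j` that the negative binomial
distribution with (real) parameter `r` and parameter `q` gives to `j`. -/
noncomputable def negBinomial (r q : ℝ) (j : ℕ) : ℝ :=
  Real.Gamma (r + j) / (j.factorial * Real.Gamma r) * q ^ r * (1 - q) ^ j

/-- The difference between the variance and the mean of the 2-runs statistic. -/
noncomputable def runsExcess (n : ℕ) (p : ℝ) : ℝ :=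
  n * p ^ 3 * (2 - 3 * p) - 2 * p ^ 3 * (1 - p)

/-- The parameter `p̄` of the matching negative binomial distribution. -/
noncomputable def runsPbar (n : ℕ) (p : ℝ) : ℝ :=
  runsExcess n p / (n * p ^ 2 + runsExcess n p)

/-- The parameter `q̄ = 1 - p̄` of the matching negative binomial distribution. -/
noncomputable def runsQbar (n : ℕ) (p : ℝ) : ℝ := 1 - runsPbar n p

/-- The parameter `r` of the matching negative binomial distribution. -/
noncomputable def runsR (n : ℕ) (p : ℝ) : ℝ := (n : ℝ) ^ 2 * p ^ 4 / runsExcess n p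

/-!
Conditioning on the first variable gives the generating function `G n` of the 2-runs statistic a
two-term recursion `G (n + 2) = (1 + p u) G (n + 1) - p (1 - p) u G n` in `u = z - 1`, so that `G n`
is a product of factors `1 + e k` with `e k = O(p² u)`. Hence `log (G n)` has a quadratic expansion
at `u = 0` with error `O(n p⁴ |u|³)`. Since the mean and the variance match, the negative binomial
generating function `N` has the same quadratic part, and `G n = N · exp D` with
`D = O(n p⁴ |u|³)`.

Compare the coefficients of `z ^ x` by Cauchy's formula on the circle of radius `ρ`, where `ρ` is
the saddle point of `N z / z ^ x`. There `|u| ≤ |ρ - 1| + |θ|`, so `D` is at most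
`τ + O(p² x θ²)` with `τ = O(|x - n p²|³ / (n p)²) = o(1)`, while `|N|` decays like the Gaussian
`exp (-x θ² / 50)`. The coefficients thus differ by `O(τ + p²)` times `N ρ / (ρ ^ x √x)`, and
Stirling's formula, applied to the negative binomial distribution tilted to have mean `x`, bounds
this last quantity by a constant times `NB(r, q̄){x}`.
-/

/-! ### Elementary estimates -/

theorem norm_log_one_add_sub_quadratic_le {z : ℂ} (hz : ‖z‖ ≤ 1 / 2) :
    ‖Complex.log (1 + z) - (z - z ^ 2 / 2)‖ ≤ ‖z‖ ^ 3 := by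
  have hTaylor : Complex.logTaylor 3 z = z - z ^ 2 / 2 := by
    simp only [Complex.logTaylor_succ, Complex.logTaylor_zero]
    norm_num
    ring
  have hinv : (1 - ‖z‖)⁻¹ ≤ 2 := by
    rw [inv_le_comm₀ (by linarith) (by norm_num)]
    linarith
  calc ‖Complex.log (1 + z) - (z - z ^ 2 / 2)‖
      ≤ ‖z‖ ^ 3 * (1 - ‖z‖)⁻¹ / 3 := by
        have h := Complex.norm_log_sub_logTaylor_le 2 (z := z) (by linarith)
        norm_num [hTaylor] at h ⊢
        exact h
    _ ≤ ‖z‖ ^ 3 * 2 / 3 := by gcongr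
    _ ≤ ‖z‖ ^ 3 := by linarith [pow_nonneg (norm_nonneg z) 3]

theorem one_half_le_norm_one_add {z : ℂ} (hz : ‖z‖ ≤ 1 / 2) : 1 / 2 ≤ ‖1 + z‖ := by
  have h := norm_sub_le (1 + z) z
  rw [add_sub_cancel_right, norm_one] at h
  linarith

theorem one_add_ne_zero_of_norm_le {z : ℂ} (hz : ‖z‖ ≤ 1 / 2) : 1 + z ≠ 0 :=
  norm_pos_iff.1 (one_half_pos.trans_le (one_half_le_norm_one_add hz))

theorem norm_div_one_add_le {z : ℂ} (hz : ‖z‖ ≤ 1 / 2) : ‖z / (1 + z)‖ ≤ 2 * ‖z‖ := by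
  have h := one_half_le_norm_one_add hz
  rw [norm_div, div_le_iff₀ (by linarith)]
  nlinarith [norm_nonneg z]

theorem norm_div_one_add_sub_self_le {z : ℂ} (hz : ‖z‖ ≤ 1 / 2) :
    ‖z / (1 + z) - z‖ ≤ 2 * ‖z‖ ^ 2 := by
  have hz0 := one_add_ne_zero_of_norm_le hz
  have heq : z / (1 + z) - z = -(z * (z / (1 + z))) := by field_simp; ring
  rw [heq, norm_neg, norm_mul]
  nlinarith [norm_nonneg z, norm_div_one_add_le hz]

theorem norm_exp_sub_one_le_mul_exp (z : ℂ) : ‖Complex.exp z - 1‖ ≤ ‖z‖ * Real.exp ‖z‖ := by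
  simpa using Complex.norm_exp_sub_sum_le_norm_mul_exp z 1

theorem norm_circleMap_zero_sub_one_le (ρ θ : ℝ) : ‖circleMap 0 ρ θ - 1‖ ≤ |ρ - 1| + |θ| := by
  have hsplit : circleMap 0 ρ θ - 1 =
      ((ρ - 1 : ℝ) : ℂ) * Complex.exp (θ * Complex.I) + (Complex.exp (Complex.I * θ) - 1) := by
    rw [circleMap_zero, mul_comm Complex.I]
    push_cast
    ring
  rw [hsplit]
  refine norm_add_le_of_le ?_ ?_
  · rw [norm_mul, Complex.norm_exp_ofReal_mul_I, mul_one, Complex.norm_real, Real.norm_eq_abs]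
  · simpa using Real.norm_exp_I_mul_ofReal_sub_one_le (x := θ)

theorem mul_exp_le_gaussian {a b s y B : ℝ} (ha : 0 ≤ a) (hb : 0 ≤ b) (hs : 0 < s) (hy : 0 ≤ y)
    (hbs : b ≤ s / 3) (hB : B ≤ a + b * y) :
    Real.exp (-(s * y)) * (B * Real.exp B) ≤
      Real.exp a * (a + 3 * b / s) * Real.exp (-(s / 3 * y)) := by
  have hpoly : a + b * y ≤ (a + 3 * b / s) * Real.exp (s / 3 * y) := by
    have hone : 1 ≤ Real.exp (s / 3 * y) := Real.one_le_exp (by positivity)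
    have hlin : s / 3 * y ≤ Real.exp (s / 3 * y) := by
      linarith [Real.add_one_le_exp (s / 3 * y)]
    calc a + b * y = a * 1 + 3 * b / s * (s / 3 * y) := by field_simp
      _ ≤ a * Real.exp (s / 3 * y) + 3 * b / s * Real.exp (s / 3 * y) := by gcongr
      _ = _ := by ring
  have hexp : Real.exp B ≤ Real.exp a * Real.exp (s / 3 * y) := by
    rw [← Real.exp_add]
    exact Real.exp_le_exp.2 (hB.trans (by gcongr))
  have hcancel : Real.exp (-(s * y)) * (Real.exp (s / 3 * y) * Real.exp (s / 3 * y)) =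
      Real.exp (-(s / 3 * y)) := by
    rw [← Real.exp_add, ← Real.exp_add]
    congr 1
    ring
  calc Real.exp (-(s * y)) * (B * Real.exp B)
      ≤ Real.exp (-(s * y)) * (((a + 3 * b / s) * Real.exp (s / 3 * y)) *
          (Real.exp a * Real.exp (s / 3 * y))) := by
        have := hB.trans hpoly
        gcongr
    _ = Real.exp a * (a + 3 * b / s) *
          (Real.exp (-(s * y)) * (Real.exp (s / 3 * y) * Real.exp (s / 3 * y))) := by ring
    _ = _ := by rw [hcancel]

/-! ### Cauchy's coefficient bound -/

theorem integral_exp_int_mul_I {m : ℤ} (hm : m ≠ 0) :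
    ∫ θ : ℝ in -Real.pi..Real.pi, Complex.exp (m * Complex.I * θ) = 0 := by
  have hc : (m * Complex.I : ℂ) ≠ 0 := mul_ne_zero (by exact_mod_cast hm) Complex.I_ne_zero
  have hperiod : (m * Complex.I * (Real.pi : ℝ) : ℂ) =
      m * Complex.I * ((-Real.pi : ℝ) : ℂ) + m * (2 * Real.pi * Complex.I) := by
    push_cast
    ring
  rw [integral_exp_mul_complex hc, hperiod, Complex.exp_periodic.int_mul m _, sub_self, zero_div]

section Cauchy

variable {c : ℕ → ℂ} {F : ℂ → ℂ} {ρ : ℝ}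

theorem integral_hasSum_mul_exp_neg
    (hF : ∀ z ∈ Metric.sphere 0 ρ, HasSum (fun j => c j * z ^ j) (F z)) (hρ : 0 ≤ ρ) (x : ℕ) :
    ∫ θ : ℝ in -Real.pi..Real.pi, F (circleMap 0 ρ θ) * Complex.exp (-(x * Complex.I * θ)) =
      2 * Real.pi * (c x * ρ ^ x) := by
  have hterm (j : ℕ) (θ : ℝ) : c j * circleMap 0 ρ θ ^ j * Complex.exp (-(x * Complex.I * θ)) =
      c j * ρ ^ j * Complex.exp ((j - x : ℤ) * Complex.I * θ) := by
    rw [circleMap_zero, mul_pow, ← Complex.exp_nat_mul, ← mul_assoc, mul_assoc _ (Complex.exp _),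
      ← Complex.exp_add]
    congr 2
    push_cast
    ring
  have hint (j : ℕ) : ∫ θ : ℝ in -Real.pi..Real.pi,
      c j * circleMap 0 ρ θ ^ j * Complex.exp (-(x * Complex.I * θ)) =
        if j = x then 2 * Real.pi * (c x * ρ ^ x) else 0 := by
    simp_rw [hterm, intervalIntegral.integral_const_mul]
    split_ifs with h
    · subst h
      simp
      ring
    · rw [integral_exp_int_mul_I (by omega), mul_zero]
  have hnorm (j : ℕ) (θ : ℝ) :
      ‖c j * circleMap 0 ρ θ ^ j * Complex.exp (-(x * Complex.I * θ))‖ = ‖c j * ρ ^ j‖ := by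
    have hreal : ((j - x : ℤ) * Complex.I * θ : ℂ) = (((j - x : ℤ) * θ : ℝ) : ℂ) * Complex.I := by
      push_cast
      ring
    rw [hterm, norm_mul, hreal, Complex.norm_exp_ofReal_mul_I, mul_one]
  have hsummable : Summable fun j => ‖c j * (ρ : ℂ) ^ j‖ :=
    (hF ρ (by simp [abs_of_nonneg hρ])).summable.norm
  have hsum := intervalIntegral.hasSum_integral_of_dominated_convergence (μ := volume)
    (a := -Real.pi) (b := Real.pi) (fun j _ => ‖c j * (ρ : ℂ) ^ j‖)
    (fun j => (by fun_prop : Continuous fun θ : ℝ =>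
      c j * circleMap 0 ρ θ ^ j * Complex.exp (-(x * Complex.I * θ))).aestronglyMeasurable)
    (fun j => .of_forall fun θ _ => (hnorm j θ).le) (.of_forall fun _ _ => hsummable) (by simp)
    (.of_forall fun θ _ => (hF _ (circleMap_mem_sphere 0 hρ θ)).mul_right _)
  simp_rw [hint] at hsum
  exact hsum.unique (hasSum_ite_eq x _)

theorem norm_coeff_mul_pow_le_of_gaussian
    (hF : ∀ z ∈ Metric.sphere 0 ρ, HasSum (fun j => c j * z ^ j) (F z)) (hρ : 0 ≤ ρ) {A s : ℝ}
    (hs : 0 < s) (hb : ∀ θ, |θ| ≤ Real.pi → ‖F (circleMap 0 ρ θ)‖ ≤ A * Real.exp (-s * θ ^ 2))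
    (x : ℕ) : ‖c x‖ * ρ ^ x ≤ A / (2 * √(Real.pi * s)) := by
  have hπ := Real.pi_pos
  have hA : 0 ≤ A := by simpa using (norm_nonneg _).trans (hb 0 (by simpa using hπ.le))
  have hunit (θ : ℝ) : ‖Complex.exp (-(x * Complex.I * θ))‖ = 1 := by
    have hreal : (-(x * Complex.I * θ) : ℂ) = ((-(x * θ) : ℝ) : ℂ) * Complex.I := by
      push_cast
      ring
    rw [hreal, Complex.norm_exp_ofReal_mul_I]
  have hlocal : 2 * Real.pi * (‖c x‖ * ρ ^ x) ≤
      ∫ θ in -Real.pi..Real.pi, A * Real.exp (-s * θ ^ 2) := by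
    calc 2 * Real.pi * (‖c x‖ * ρ ^ x) = ‖2 * Real.pi * (c x * ρ ^ x)‖ := by
          simp [abs_of_pos hπ, abs_of_nonneg hρ]
      _ ≤ _ := by
          rw [← integral_hasSum_mul_exp_neg hF hρ x]
          refine intervalIntegral.norm_integral_le_of_norm_le (by linarith)
            (.of_forall fun θ hθ => ?_) (Continuous.intervalIntegrable (by fun_prop) _ _)
          rw [norm_mul, hunit, mul_one]
          exact hb θ (abs_le.2 ⟨hθ.1.le, hθ.2⟩)
  have hglobal : ∫ θ in -Real.pi..Real.pi, A * Real.exp (-s * θ ^ 2) ≤ A * √(Real.pi / s) := by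
    rw [intervalIntegral.integral_const_mul, ← integral_gaussian,
      intervalIntegral.integral_of_le (by linarith)]
    exact mul_le_mul_of_nonneg_left (setIntegral_le_integral (integrable_exp_neg_mul_sq hs)
      (.of_forall fun _ => (Real.exp_pos _).le)) hA
  have hsqrt : √(Real.pi / s) = Real.pi / √(Real.pi * s) := by
    rw [Real.sqrt_div hπ.le, Real.sqrt_mul hπ.le, ← div_div, Real.div_sqrt]
  rw [hsqrt] at hglobal
  refine le_of_mul_le_mul_left ?_ (show 0 < 2 * Real.pi by positivity)
  calc 2 * Real.pi * (‖c x‖ * ρ ^ x) ≤ A * (Real.pi / √(Real.pi * s)) := hlocal.trans hglobal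
    _ = 2 * Real.pi * (A / (2 * √(Real.pi * s))) := by field_simp

end Cauchy

/-! ### The negative binomial distribution -/

theorem add_one_rpow_le {t : ℝ} (ht : 0 < t) : (t + 1) ^ t ≤ Real.exp 1 * t ^ t := by
  have hbase : t + 1 ≤ t * Real.exp (1 / t) := by
    calc t + 1 = t * (1 / t + 1) := by field_simp; ring
      _ ≤ _ := mul_le_mul_of_nonneg_left (Real.add_one_le_exp _) ht.le
  calc (t + 1) ^ t ≤ (t * Real.exp (1 / t)) ^ t := by gcongr
    _ = Real.exp 1 * t ^ t := by
      rw [Real.mul_rpow ht.le (Real.exp_pos _).le, ← Real.exp_mul, one_div_mul_cancel ht.ne',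
        mul_comm]

theorem rpow_mul_rpow_mul_Gamma_le_Gamma_add {r : ℝ} (hr : 0 < r) (x : ℕ) :
    r ^ (1 - r) * (r + x) ^ (r + x - 1) * Real.exp (-x) * Real.Gamma r ≤ Real.Gamma (r + x) := by
  induction x with
  | zero => simp [← Real.rpow_add hr]
  | succ x ih =>
    have ht : 0 < r + x := by positivity
    have hΓ : Real.Gamma (r + (x + 1 : ℕ)) = (r + x) * Real.Gamma (r + x) := by
      rw [← Real.Gamma_add_one ht.ne']
      push_cast
      ring_nf
    have hstep : (r + (x + 1 : ℕ)) ^ (r + (x + 1 : ℕ) - 1) * Real.exp (-(x + 1 : ℕ)) ≤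
        (r + x) * ((r + x) ^ (r + x - 1) * Real.exp (-x)) := by
      calc (r + (x + 1 : ℕ)) ^ (r + (x + 1 : ℕ) - 1) * Real.exp (-(x + 1 : ℕ))
          = (r + x + 1) ^ (r + x) * Real.exp (-(x + 1 : ℕ)) := by push_cast; ring_nf
        _ ≤ Real.exp 1 * (r + x) ^ (r + x) * Real.exp (-(x + 1 : ℕ)) := by
          gcongr
          exact add_one_rpow_le ht
        _ = (r + x) ^ (r + x) * Real.exp (-x) := by
          rw [mul_comm (Real.exp 1), mul_assoc, ← Real.exp_add]
          push_cast
          ring_nf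
        _ = (r + x) * ((r + x) ^ (r + x - 1) * Real.exp (-x)) := by
          rw [Real.rpow_sub_one ht.ne']
          field_simp
    have hpos : 0 < r ^ (1 - r) * Real.Gamma r :=
      mul_pos (Real.rpow_pos_of_pos hr _) (Real.Gamma_pos_of_pos hr)
    rw [hΓ]
    nlinarith [mul_le_mul_of_nonneg_left hstep hpos.le, mul_le_mul_of_nonneg_left ih ht.le]

theorem factorial_le_stirling {x : ℕ} (hx : x ≠ 0) :
    (x.factorial : ℝ) ≤ Real.exp 1 * √x * (x / Real.exp 1) ^ x := by
  obtain ⟨m, rfl⟩ := Nat.exists_eq_succ_of_ne_zero hx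
  have h := Stirling.stirlingSeq'_antitone m.zero_le
  simp only [Function.comp_apply, Nat.succ_eq_add_one, zero_add, Stirling.stirlingSeq_one] at h
  rw [Stirling.stirlingSeq, div_le_iff₀ (by positivity), Real.sqrt_mul (by norm_num)] at h
  refine h.trans (le_of_eq ?_)
  simp only [Nat.succ_eq_add_one]
  field_simp

theorem negBinomial_pos {r q : ℝ} (hr : 0 < r) (hq0 : 0 < q) (hq1 : q < 1) (x : ℕ) :
    0 < negBinomial r q x := by
  have := Real.Gamma_pos_of_pos hr
  have := Real.Gamma_pos_of_pos (show 0 < r + x by positivity)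
  have := sub_pos.2 hq1
  have := x.factorial_pos
  unfold negBinomial
  positivity

/- `r / (r + x)` is the parameter for which the negative binomial distribution has mean `x`. -/
theorem le_negBinomial_div_add {r : ℝ} (hr : 0 < r) {x : ℕ} (hx : x ≠ 0) :
    r / (r + x) / (Real.exp 1 * √x) ≤ negBinomial r (r / (r + x)) x := by
  have : (0 : ℝ) < x := by exact_mod_cast Nat.pos_of_ne_zero hx
  have hrx : 0 < r + x := by positivity
  have := Real.Gamma_pos_of_pos hr
  have hcompl : 1 - r / (r + x) = x / (r + x) := by field_simp; ring
  have hcancel : r ^ (1 - r) * (r + x) ^ (r + x - 1) * Real.exp (-x) * Real.Gamma r /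
      (Real.exp 1 * √x * (x / Real.exp 1) ^ x * Real.Gamma r) *
        (r / (r + x)) ^ r * (x / (r + x)) ^ x = r / (r + x) / (Real.exp 1 * √x) := by
    have hexp : Real.exp (-x) = (Real.exp 1 ^ x)⁻¹ := by
      rw [Real.exp_neg, ← Real.exp_nat_mul, mul_one]
    rw [hexp, Real.rpow_sub hr, Real.rpow_one, Real.rpow_sub_one hrx.ne', Real.rpow_add hrx,
      Real.rpow_natCast, Real.div_rpow hr.le hrx.le, div_pow, div_pow]
    field_simp
  rw [negBinomial, hcompl, ← hcancel]
  gcongr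
  · exact rpow_mul_rpow_mul_Gamma_le_Gamma_add hr x
  · exact factorial_le_stirling hx

theorem negBinomial_mul_pow {r q ρ : ℝ} (hρ : (1 - q) * ρ < 1) (x : ℕ) :
    negBinomial r q x * ρ ^ x =
      q ^ r / (1 - (1 - q) * ρ) ^ r * negBinomial r (1 - (1 - q) * ρ) x := by
  have hne := (Real.rpow_pos_of_pos (sub_pos.2 hρ) r).ne'
  rw [negBinomial, negBinomial, sub_sub_cancel, mul_pow]
  field_simp

/-- The probability generating function `(q / (1 - (1 - q) z)) ^ r` of the negative binomial
distribution, through which that distribution enters the local limit theorem. Numerator and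
denominator carry separate (principal) powers. -/
noncomputable def negBinomialGenFun (r q : ℝ) (z : ℂ) : ℂ :=
  (q : ℂ) ^ (r : ℂ) / (1 - (1 - q) * z) ^ (r : ℂ)

theorem choose_add_natCast_sub_one {r : ℝ} (hr : 0 < r) (j : ℕ) :
    Ring.choose ((r : ℂ) + j - 1) j =
      ((Real.Gamma (r + j) / (j.factorial * Real.Gamma r) : ℝ) : ℂ) := by
  have hpole (k : ℕ) : (r : ℂ) ≠ -k := by
    norm_cast
    have := k.cast_nonneg (α := ℝ)
    push_cast
    linarith
  have hfactorial : (j.factorial : ℂ) * Ring.multichoose (r : ℂ) j =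
      Complex.Gamma (r + j) / Complex.Gamma r := by
    rw [Complex.Gamma_add_nat_div_Gamma_eq _ hpole, ← nsmul_eq_mul,
      Ring.factorial_nsmul_multichoose_eq_ascPochhammer, Polynomial.ascPochhammer_smeval_eq_eval]
  rw [← Ring.multichoose_eq, eq_div_of_mul_eq (by exact_mod_cast j.factorial_ne_zero)
    ((mul_comm _ _).trans hfactorial), div_div, mul_comm (Complex.Gamma r)]
  push_cast [← Complex.Gamma_ofReal]
  rfl

theorem hasSum_negBinomial {r q : ℝ} (hr : 0 < r) (hq : 0 ≤ q) {z : ℂ} (hz : ‖(1 - q) * z‖ < 1) :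
    HasSum (fun j => (negBinomial r q j : ℂ) * z ^ j) (negBinomialGenFun r q z) := by
  have hball : (1 - q) * z ∈ Metric.eball (0 : ℂ) 1 := by
    rw [Metric.mem_eball, edist_zero_right, ← ofReal_norm]
    exact ENNReal.ofReal_lt_one.2 hz
  have hbinomial :=
    (Complex.one_div_one_sub_cpow_hasFPowerSeriesOnBall_zero (r : ℂ)).hasSum hball
  rw [zero_add] at hbinomial
  rw [negBinomialGenFun, div_eq_mul_one_div]
  convert! hbinomial.mul_left ((q : ℂ) ^ (r : ℂ)) using 2 with j
  rw [FormalMultilinearSeries.ofScalars_apply_eq, choose_add_natCast_sub_one hr, negBinomial,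
    smul_eq_mul, mul_pow]
  push_cast [Complex.ofReal_cpow hq]
  ring

theorem one_sub_mul_exp_le_norm {a θ : ℝ} (ha0 : 0 ≤ a) (ha1 : a ≤ 1) (hθ : |θ| ≤ Real.pi) :
    (1 - a) * Real.exp (a * θ ^ 2 / 25) ≤ ‖1 - a * Complex.exp (θ * Complex.I)‖ := by
  set t := 2 * a * (1 - Real.cos θ)
  have hsq : ‖1 - a * Complex.exp (θ * Complex.I)‖ ^ 2 = (1 - a) ^ 2 + t := by
    rw [Complex.sq_norm, Complex.normSq_apply]
    simp only [Complex.sub_re, Complex.one_re, Complex.mul_re, Complex.ofReal_re,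
      Complex.exp_ofReal_mul_I_re, Complex.ofReal_im, Complex.exp_ofReal_mul_I_im,
      Complex.sub_im, Complex.one_im, Complex.mul_im]
    linear_combination a ^ 2 * Real.sin_sq_add_cos_sq θ
  have hcos : θ ^ 2 / 5 ≤ 1 - Real.cos θ := by
    have hπ : 1 / 5 ≤ 2 / Real.pi ^ 2 := by
      rw [div_le_div_iff₀ (by norm_num) (by positivity)]
      nlinarith [Real.pi_lt_d2, Real.pi_pos]
    nlinarith [Real.cos_le_one_sub_mul_cos_sq hθ, sq_nonneg θ]
  have ht0 : 2 * a * θ ^ 2 / 5 ≤ t := by nlinarith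
  have ht4 : t ≤ 4 := by nlinarith [Real.neg_one_le_cos θ]
  have ht_nonneg : 0 ≤ t := le_trans (by positivity) ht0
  have hexp : Real.exp (t / 5) ≤ 1 + t := by
    have h := Real.one_sub_le_exp_neg (t / 5)
    rw [Real.exp_neg, le_inv_comm₀ (by linarith) (Real.exp_pos _)] at h
    exact h.trans (inv_le_of_inv_le₀ (by linarith) (by
      rw [inv_le_comm₀ (by linarith) (by linarith), inv_le_iff_one_le_mul₀ (by linarith)]
      nlinarith))
  refine le_of_sq_le_sq ?_ (norm_nonneg _)
  rw [hsq]
  calc ((1 - a) * Real.exp (a * θ ^ 2 / 25)) ^ 2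
      = (1 - a) ^ 2 * Real.exp (2 * a * θ ^ 2 / 5 / 5) := by
        rw [mul_pow, ← Real.exp_nat_mul]
        push_cast
        ring_nf
    _ ≤ (1 - a) ^ 2 * (1 + t) := by
        gcongr
        exact (Real.exp_le_exp.2 (by linarith)).trans hexp
    _ ≤ (1 - a) ^ 2 + t := by
        have : (1 - a) ^ 2 ≤ 1 := by nlinarith
        nlinarith

theorem norm_negBinomialGenFun_circleMap_le {r q ρ θ : ℝ} (hr : 0 ≤ r) (hq0 : 0 < q) (hq1 : q ≤ 1)
    (hρ : 0 ≤ ρ) (hρ1 : (1 - q) * ρ < 1) (hθ : |θ| ≤ Real.pi) :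
    ‖negBinomialGenFun r q (circleMap 0 ρ θ)‖ ≤
      q ^ r / (1 - (1 - q) * ρ) ^ r * Real.exp (-(r * ((1 - q) * ρ) * θ ^ 2 / 25)) := by
  set a := (1 - q) * ρ with ha
  have ha0 : 0 ≤ a := mul_nonneg (sub_nonneg.2 hq1) hρ
  have : 0 < (1 - a) * Real.exp (a * θ ^ 2 / 25) :=
    mul_pos (sub_pos.2 hρ1) (Real.exp_pos _)
  have hz : (1 - q : ℂ) * circleMap 0 ρ θ = a * Complex.exp (θ * Complex.I) := by
    rw [circleMap_zero, ha]
    push_cast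
    ring
  rw [negBinomialGenFun, hz, norm_div, Complex.norm_cpow_real, Complex.norm_cpow_real,
    Complex.norm_real, Real.norm_of_nonneg hq0.le]
  calc q ^ r / ‖1 - a * Complex.exp (θ * Complex.I)‖ ^ r
      ≤ q ^ r / ((1 - a) * Real.exp (a * θ ^ 2 / 25)) ^ r := by
        gcongr
        exact one_sub_mul_exp_le_norm ha0 hρ1.le hθ
    _ = q ^ r / (1 - a) ^ r * Real.exp (-(r * a * θ ^ 2 / 25)) := by
        rw [Real.mul_rpow (sub_nonneg.2 hρ1.le) (Real.exp_pos _).le, ← Real.exp_mul, Real.exp_neg]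
        field_simp

theorem exists_negBinomialGenFun_eq_exp {r q : ℝ} (hr : 0 ≤ r) (hq0 : 0 < q) (hq1 : q ≤ 1) {u : ℂ}
    (hu : (1 - q) / q * ‖u‖ ≤ 1 / 2) :
    ∃ L : ℂ, negBinomialGenFun r q (1 + u) = Complex.exp L ∧
      ‖L - ((r * ((1 - q) / q) : ℝ) * u + (r * ((1 - q) / q) ^ 2 : ℝ) / 2 * u ^ 2)‖ ≤
        r * ((1 - q) / q) ^ 3 * ‖u‖ ^ 3 := by
  set κ := (1 - q) / q with hκ
  have hκ0 : 0 ≤ κ := div_nonneg (sub_nonneg.2 hq1) hq0.le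
  have hnorm : ‖-((κ : ℂ) * u)‖ = κ * ‖u‖ := by
    rw [norm_neg, norm_mul, Complex.norm_real, Real.norm_of_nonneg hκ0]
  have hne : 1 + -((κ : ℂ) * u) ≠ 0 := one_add_ne_zero_of_norm_le (hnorm.trans_le hu)
  have hqC : (q : ℂ) ≠ 0 := by exact_mod_cast hq0.ne'
  have hfactor : (1 - (1 - q) * (1 + u) : ℂ) = q * (1 + -(κ * u)) := by
    rw [hκ]
    push_cast
    field_simp
    ring
  refine ⟨-(r * Complex.log (1 + -(κ * u))), ?_, ?_⟩
  · rw [negBinomialGenFun, hfactor, div_eq_mul_inv, ← Complex.cpow_neg,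
      Complex.cpow_def_of_ne_zero hqC, Complex.cpow_def_of_ne_zero (mul_ne_zero hqC hne),
      ← Complex.exp_add, Complex.log_ofReal_mul hq0 hne, Complex.ofReal_log hq0.le]
    ring_nf
  · have hlog := norm_log_one_add_sub_quadratic_le (hnorm.trans_le hu)
    rw [hnorm] at hlog
    have hsplit : -(r * Complex.log (1 + -(κ * u))) -
        ((r * κ : ℝ) * u + (r * κ ^ 2 : ℝ) / 2 * u ^ 2) =
          -(r * (Complex.log (1 + -(κ * u)) - (-(κ * u) - (-(κ * u)) ^ 2 / 2))) := by
      push_cast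
      ring
    rw [hsplit, norm_neg, norm_mul, Complex.norm_real, Real.norm_of_nonneg hr, mul_assoc,
      ← mul_pow]
    exact mul_le_mul_of_nonneg_left hlog hr

/-- The saddle point of `z ↦ negBinomialGenFun r q z / z ^ x`: the radius of the circle on which the
coefficient of `z ^ x` is estimated. Tilting by it turns `NB(r, q)` into the negative binomial
distribution with mean `x`. -/
noncomputable def negBinomialSaddle (r q : ℝ) (x : ℕ) : ℝ := x / ((r + x) * (1 - q))

theorem one_sub_mul_negBinomialSaddle {q : ℝ} (hq : q ≠ 1) (r : ℝ) (x : ℕ) :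
    (1 - q) * negBinomialSaddle r q x = x / (r + x) := by
  have := sub_ne_zero.2 hq.symm
  rw [negBinomialSaddle]
  field_simp

theorem abs_negBinomialSaddle_sub_one_le {r q : ℝ} (hr : 0 < r) (hq0 : 0 < q) (hq1 : q < 1)
    (x : ℕ) : |negBinomialSaddle r q x - 1| ≤
      |x - r * ((1 - q) / q)| / (r * ((1 - q) / q)) := by
  have hq : 0 < 1 - q := sub_pos.2 hq1
  have hsplit : negBinomialSaddle r q x - 1 =
      (x - r * ((1 - q) / q)) / ((r + x) * ((1 - q) / q)) := by
    rw [negBinomialSaddle]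
    field_simp
    ring
  rw [hsplit, abs_div, abs_of_pos (show 0 < (r + x) * ((1 - q) / q) by positivity)]
  gcongr
  exact le_add_of_nonneg_right x.cast_nonneg

theorem norm_negBinomialGenFun_negBinomialSaddle_le {r q θ : ℝ} (hr : 0 < r) (hq0 : 0 < q)
    (hq1 : q < 1) {x : ℕ} (hxr : x ≤ r) (hθ : |θ| ≤ Real.pi) :
    ‖negBinomialGenFun r q (circleMap 0 (negBinomialSaddle r q x) θ)‖ ≤
      q ^ r / (r / (r + x)) ^ r * Real.exp (-(1 / 50 * (x * θ ^ 2))) := by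
  have : 0 < 1 - q := sub_pos.2 hq1
  have hrx : 0 < r + x := by positivity
  have hsaddle := one_sub_mul_negBinomialSaddle hq1.ne r x
  have hcompl : 1 - x / (r + x) = r / (r + x) := by field_simp; ring
  have h := norm_negBinomialGenFun_circleMap_le hr.le hq0 hq1.le
    (show 0 ≤ negBinomialSaddle r q x by unfold negBinomialSaddle; positivity)
    (by rw [hsaddle, div_lt_one hrx]; linarith) hθ
  rw [hsaddle, hcompl] at h
  refine h.trans ?_
  have hhalf : (x : ℝ) / 2 ≤ r * (x / (r + x)) := by
    rw [← mul_div_assoc, div_le_div_iff₀ two_pos hrx]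
    nlinarith [x.cast_nonneg (α := ℝ)]
  gcongr
  nlinarith [sq_nonneg θ]

theorem le_negBinomial_mul_negBinomialSaddle_pow {r q : ℝ} (hr : 0 < r) (hq0 : 0 ≤ q) (hq1 : q ≠ 1)
    {x : ℕ} (hx : x ≠ 0) (hxr : x ≤ r) :
    q ^ r / (r / (r + x)) ^ r / (2 * (Real.exp 1 * √x)) ≤
      negBinomial r q x * negBinomialSaddle r q x ^ x := by
  have hrx : 0 < r + x := by positivity
  have hsaddle := one_sub_mul_negBinomialSaddle hq1 r x
  have hcompl : 1 - x / (r + x) = r / (r + x) := by field_simp; ring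
  have hhalf : 1 / 2 ≤ r / (r + x) := by
    rw [div_le_div_iff₀ two_pos hrx]
    linarith
  rw [negBinomial_mul_pow (by rw [hsaddle, div_lt_one hrx]; linarith), hsaddle, hcompl]
  calc q ^ r / (r / (r + x)) ^ r / (2 * (Real.exp 1 * √x))
      = q ^ r / (r / (r + x)) ^ r * (1 / 2 / (Real.exp 1 * √x)) := by field_simp
    _ ≤ q ^ r / (r / (r + x)) ^ r * (r / (r + x) / (Real.exp 1 * √x)) := by gcongr
    _ ≤ _ := by
      gcongr
      exact le_negBinomial_div_add hr hx

theorem hasSum_negBinomial_of_mem_sphere {r q : ℝ} (hr : 0 < r) (hq0 : 0 ≤ q) (hq1 : q < 1) {x : ℕ}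
    {z : ℂ} (hz : z ∈ Metric.sphere 0 (negBinomialSaddle r q x)) :
    HasSum (fun j => (negBinomial r q j : ℂ) * z ^ j) (negBinomialGenFun r q z) := by
  refine hasSum_negBinomial hr hq0 ?_
  rw [norm_mul, mem_sphere_zero_iff_norm.1 hz, ← Complex.ofReal_one, ← Complex.ofReal_sub,
    Complex.norm_real, Real.norm_of_nonneg (sub_nonneg.2 hq1.le),
    one_sub_mul_negBinomialSaddle hq1.ne, div_lt_one (by positivity)]
  linarith

theorem norm_negBinomialGenFun_mul_exp_sub_self_le {r q θ : ℝ} (hr : 0 < r) (hq0 : 0 < q)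
    (hq1 : q < 1) {x : ℕ} (hxr : x ≤ r) (hθ : |θ| ≤ Real.pi) {a b : ℝ} (ha : 0 ≤ a) (hb0 : 0 ≤ b)
    (hb1 : b ≤ 1 / 150) {D : ℂ} (hD : ‖D‖ ≤ a + b * (x * θ ^ 2)) :
    ‖negBinomialGenFun r q (circleMap 0 (negBinomialSaddle r q x) θ) * Complex.exp D -
        negBinomialGenFun r q (circleMap 0 (negBinomialSaddle r q x) θ)‖ ≤
      q ^ r / (r / (r + x)) ^ r * (Real.exp a * (a + 150 * b)) *
        Real.exp (-(x / 150) * θ ^ 2) := by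
  have hgauss := mul_exp_le_gaussian ha hb0 (s := 1 / 50) (by norm_num)
    (show 0 ≤ x * θ ^ 2 by positivity) (by linarith) hD
  rw [← mul_sub_one, norm_mul]
  calc _ ≤ q ^ r / (r / (r + x)) ^ r * Real.exp (-(1 / 50 * (x * θ ^ 2))) *
        (‖D‖ * Real.exp ‖D‖) :=
        mul_le_mul (norm_negBinomialGenFun_negBinomialSaddle_le hr hq0 hq1 hxr hθ)
          (norm_exp_sub_one_le_mul_exp D) (norm_nonneg _) (by positivity)
    _ ≤ q ^ r / (r / (r + x)) ^ r *
        (Real.exp a * (a + 3 * b / (1 / 50)) * Real.exp (-(1 / 50 / 3 * (x * θ ^ 2)))) := by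
        rw [mul_assoc]
        gcongr
    _ = _ := by ring_nf

theorem abs_sub_negBinomial_le {r q : ℝ} (hq0 : 0 < q) (hq1 : q < 1) {x : ℕ} (hx : x ≠ 0)
    (hxr : x ≤ r) {c : ℕ → ℝ} {F : ℂ → ℂ}
    (hF : ∀ z ∈ Metric.sphere 0 (negBinomialSaddle r q x),
      HasSum (fun j => (c j : ℂ) * z ^ j) (F z))
    {a b : ℝ} (ha : 0 ≤ a) (hb0 : 0 ≤ b) (hb1 : b ≤ 1 / 150)
    (hD : ∀ θ, |θ| ≤ Real.pi → ∃ D : ℂ, F (circleMap 0 (negBinomialSaddle r q x) θ) =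
      negBinomialGenFun r q (circleMap 0 (negBinomialSaddle r q x) θ) * Complex.exp D ∧
        ‖D‖ ≤ a + b * (x * θ ^ 2)) :
    |c x - negBinomial r q x| ≤ 20 * Real.exp a * (a + 150 * b) * negBinomial r q x := by
  have hx0 : (0 : ℝ) < x := by exact_mod_cast Nat.pos_of_ne_zero hx
  have hr : 0 < r := hx0.trans_le hxr
  have hρ : 0 < negBinomialSaddle r q x :=
    div_pos hx0 (mul_pos (by positivity) (sub_pos.2 hq1))
  set M := q ^ r / (r / (r + x)) ^ r
  set K := Real.exp a * (a + 150 * b) with hK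
  have hdiff : ∀ z ∈ Metric.sphere 0 (negBinomialSaddle r q x),
      HasSum (fun j => ((c j - negBinomial r q j : ℝ) : ℂ) * z ^ j)
        (F z - negBinomialGenFun r q z) := fun z hz => by
    simpa [sub_mul] using (hF z hz).sub (hasSum_negBinomial_of_mem_sphere hr hq0.le hq1 hz)
  have hcircle (θ : ℝ) (hθ : |θ| ≤ Real.pi) :
      ‖F (circleMap 0 (negBinomialSaddle r q x) θ) -
        negBinomialGenFun r q (circleMap 0 (negBinomialSaddle r q x) θ)‖ ≤
          M * K * Real.exp (-(x / 150) * θ ^ 2) := by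
    obtain ⟨D, hFD, hDle⟩ := hD θ hθ
    rw [hFD]
    exact norm_negBinomialGenFun_mul_exp_sub_self_le hr hq0 hq1 hxr hθ ha hb0 hb1 hDle
  have hcauchy := norm_coeff_mul_pow_le_of_gaussian hdiff hρ.le (by positivity) hcircle x
  rw [Complex.norm_real, Real.norm_eq_abs] at hcauchy
  have hconst : Real.exp 1 * √x ≤ 20 * √(Real.pi * (x / 150)) := by
    refine le_of_sq_le_sq ?_ (by positivity)
    rw [mul_pow, mul_pow, Real.sq_sqrt hx0.le, Real.sq_sqrt (by positivity)]
    have he : Real.exp 1 ^ 2 ≤ 8 := by nlinarith [Real.exp_one_lt_d9, Real.exp_pos 1]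
    nlinarith [Real.pi_gt_three]
  refine le_of_mul_le_mul_right ?_ (pow_pos hρ x)
  calc |c x - negBinomial r q x| * negBinomialSaddle r q x ^ x
      ≤ M * K / (2 * √(Real.pi * (x / 150))) := hcauchy
    _ ≤ M * K / (2 * (Real.exp 1 * √x / 20)) := by
      gcongr
      linarith
    _ = 20 * K * (M / (2 * (Real.exp 1 * √x))) := by field_simp
    _ ≤ 20 * K * (negBinomial r q x * negBinomialSaddle r q x ^ x) := by
      gcongr
      exact le_negBinomial_mul_negBinomialSaddle_pow hr hq0.le hq1.ne hx hxr
    _ = 20 * Real.exp a * (a + 150 * b) * negBinomial r q x * negBinomialSaddle r q x ^ x := by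
      rw [hK]
      ring

/-! ### The generating function of the 2-runs statistic -/

/-- The law of a Bernoulli variable with success probability `p`, as a function on `Fin 2`. -/
noncomputable def bernoulliWeight (p : ℝ) : Fin 2 → ℝ := ![1 - p, p]

namespace IsIIDBernoulli

variable {ι Ω : Type*} [MeasurableSpace Ω] {μ : Measure Ω} {p : ℝ} {η : ι → Ω → ℕ}

theorem measureReal_eq_val (h : IsIIDBernoulli μ η p) (i : ι) (d : Fin 2) :
    μ.real {ω | η i ω = d} = bernoulliWeight p d := by
  fin_cases d
  · exact h.prob_zero i
  · exact h.prob_one i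

theorem measureReal_forall_eq_val [Fintype ι] (h : IsIIDBernoulli μ η p) (b : ι → Fin 2) :
    μ.real {ω | ∀ i, η i ω = b i} = ∏ i, bernoulliWeight p (b i) := by
  have hindep := h.indep.measure_inter_preimage_eq_mul Finset.univ
    (sets := fun i => {(b i : ℕ)}) fun i _ => measurableSet_singleton _
  have hinter : {ω | ∀ i, η i ω = b i} = ⋂ i ∈ Finset.univ, η i ⁻¹' {(b i : ℕ)} := by
    ext ω
    simp
  rw [measureReal_def, hinter, hindep, ENNReal.toReal_prod]
  exact Finset.prod_congr rfl fun i _ => h.measureReal_eq_val i (b i)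

theorem ae_lt_two [Countable ι] (h : IsIIDBernoulli μ η p) : ∀ᵐ ω ∂μ, ∀ i, η i ω < 2 := by
  have := h.indep.isProbabilityMeasure
  refine ae_all_iff.2 fun i => ?_
  have hmeas (d : ℕ) : MeasurableSet {ω | η i ω = d} := h.measurable i (measurableSet_singleton d)
  have hdisj : Disjoint {ω | η i ω = 0} {ω | η i ω = 1} :=
    Set.disjoint_left.2 fun ω h0 h1 => zero_ne_one (h0.symm.trans h1)
  have htotal : μ.real ({ω | η i ω = 0} ∪ {ω | η i ω = 1}) = 1 := by
    rw [measureReal_union hdisj (hmeas 1), h.prob_zero, h.prob_one, sub_add_cancel]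
  rw [measureReal_def, ENNReal.toReal_eq_one_iff] at htotal
  have hcompl := (prob_compl_eq_zero_iff ((hmeas 0).union (hmeas 1))).2 htotal
  filter_upwards [compl_mem_ae_iff.2 hcompl] with ω hω
  rcases not_not.1 hω with h0 | h1
  · exact h0.trans_lt two_pos
  · exact h1.trans_lt one_lt_two

theorem measureReal_setOf [Fintype ι] [DecidableEq ι] (h : IsIIDBernoulli μ η p)
    (P : (ι → ℕ) → Prop) [DecidablePred P] :
    μ.real {ω | P fun i => η i ω} =
      ∑ b : ι → Fin 2 with P fun i => b i, ∏ i, bernoulliWeight p (b i) := by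
  have := h.indep.isProbabilityMeasure
  have hae : {ω | P fun i => η i ω} =ᵐ[μ]
      ⋃ b ∈ Finset.univ.filter fun b : ι → Fin 2 => P fun i => b i, {ω | ∀ i, η i ω = b i} := by
    refine eventuallyEq_set.2 (h.ae_lt_two.mono fun ω hω => ?_)
    simp only [Set.mem_ofPred_eq, Finset.mem_filter, Finset.mem_univ, true_and, Set.mem_iUnion,
      exists_prop]
    constructor
    · exact fun hP => ⟨fun i => ⟨η i ω, hω i⟩, hP, fun i => rfl⟩
    · rintro ⟨b, hP, hb⟩
      rwa [funext hb]
  rw [measureReal_congr hae, measureReal_biUnion_finset]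
  · exact Finset.sum_congr rfl fun b _ => h.measureReal_forall_eq_val b
  · exact fun b _ b' _ hbb' => Set.disjoint_left.2 fun ω hb hb' =>
      hbb' (funext fun i => Fin.ext ((hb i).symm.trans (hb' i)))
  · intro b _
    rw [Set.ofPred_forall]
    exact .iInter fun i => h.measurable i (measurableSet_singleton _)

end IsIIDBernoulli

/-- The probability generating function of the number of 2-runs in `c, b 0, …, b (n - 1)`, where `b`
consists of independent Bernoulli variables with success probability `p`. The extra first entry `c`
is what makes the function recursive in `n`; the choice `c = 0` creates no run. -/
noncomputable def runsGenFun (p : ℝ) (z : ℂ) (n : ℕ) (c : Fin 2) : ℂ :=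
  ∑ b : Fin n → Fin 2, (∏ i, (bernoulliWeight p (b i) : ℂ)) *
    z ^ ∑ i : Fin n, ((Fin.cons c b : Fin (n + 1) → Fin 2) i.castSucc : ℕ) * b i

theorem IsIIDBernoulli.hasSum_measureReal_twoRuns {Ω : Type*} [MeasurableSpace Ω] {μ : Measure Ω}
    {p : ℝ} {n : ℕ} {η : Fin (n + 1) → Ω → ℕ}
    (h : IsIIDBernoulli μ η p) (z : ℂ) :
    HasSum (fun j => (μ.real {ω | twoRuns η ω = j} : ℂ) * z ^ j) (runsGenFun p z (n + 1) 0) := by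
  have hfinite : runsGenFun p z (n + 1) 0 = ∑ b : Fin (n + 1) → Fin 2,
      ((∏ i, bernoulliWeight p (b i) : ℝ) : ℂ) *
        z ^ ∑ i : Fin n, (b i.castSucc : ℕ) * b i.succ := by
    refine Finset.sum_congr rfl fun b _ => ?_
    rw [Fin.sum_univ_succ]
    simp
  rw [hfinite]
  convert! hasSum_sum (s := Finset.univ) fun (b : Fin (n + 1) → Fin 2) _ =>
    hasSum_ite_eq (∑ i : Fin n, (b i.castSucc : ℕ) * b i.succ)
      (((∏ i, bernoulliWeight p (b i) : ℝ) : ℂ) *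
        z ^ ∑ i : Fin n, (b i.castSucc : ℕ) * b i.succ) using 2 with j
  have hlaw := h.measureReal_setOf fun v => ∑ i : Fin n, v i.castSucc * v i.succ = j
  rw [show {ω | twoRuns η ω = j} = {ω | ∑ i : Fin n, η i.castSucc ω * η i.succ ω = j} from rfl,
    hlaw, Complex.ofReal_sum, Finset.sum_mul, Finset.sum_filter]
  refine Finset.sum_congr rfl fun b _ => ?_
  split_ifs with hj hj' hj'
  · rw [hj]
  · exact absurd hj.symm hj'
  · exact absurd hj'.symm hj
  · rfl

theorem sum_fin_succ_pi {α M : Type*} [Fintype α] [AddCommMonoid M] {n : ℕ}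
    (f : (Fin (n + 1) → α) → M) :
    ∑ b, f b = ∑ d : α, ∑ b : Fin n → α, f (Fin.cons d b) := by
  rw [← (Fin.consEquiv fun _ => α).sum_comp, Fintype.sum_prod_type]
  rfl

section Recursion

variable {p : ℝ}

theorem runsGenFun_zero (z : ℂ) (c : Fin 2) : runsGenFun p z 0 c = 1 := by
  simp [runsGenFun]

theorem runsGenFun_succ (z : ℂ) (n : ℕ) (c : Fin 2) :
    runsGenFun p z (n + 1) c =
      ∑ d : Fin 2, bernoulliWeight p d * z ^ ((c : ℕ) * d) * runsGenFun p z n d := by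
  rw [runsGenFun, sum_fin_succ_pi]
  refine Finset.sum_congr rfl fun d _ => ?_
  rw [runsGenFun, Finset.mul_sum]
  refine Finset.sum_congr rfl fun b _ => ?_
  rw [Fin.prod_univ_succ, Fin.sum_univ_succ]
  simp only [Fin.cons_zero, Fin.cons_succ, Fin.castSucc_zero, ← Fin.succ_castSucc]
  rw [pow_add]
  ring

theorem runsGenFun_one (z : ℂ) : runsGenFun p z 1 0 = 1 := by
  simp [runsGenFun_succ, runsGenFun_zero, bernoulliWeight]

theorem runsGenFun_add_two (u : ℂ) (n : ℕ) :
    runsGenFun p (1 + u) (n + 2) 0 =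
      (1 + p * u) * runsGenFun p (1 + u) (n + 1) 0 -
        p * (1 - p) * u * runsGenFun p (1 + u) n 0 := by
  have hzero (m : ℕ) : runsGenFun p (1 + u) (m + 1) 0 =
      (1 - p) * runsGenFun p (1 + u) m 0 + p * runsGenFun p (1 + u) m 1 := by
    rw [runsGenFun_succ, Fin.sum_univ_two]
    simp [bernoulliWeight]
  have hone : runsGenFun p (1 + u) (n + 1) 1 =
      (1 - p) * runsGenFun p (1 + u) n 0 + p * (1 + u) * runsGenFun p (1 + u) n 1 := by
    rw [runsGenFun_succ, Fin.sum_univ_two]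
    simp [bernoulliWeight]
  linear_combination hzero (n + 1) + p * hone - (p + p * u) * hzero n

end Recursion

/-- The defect `e k` with `runsGenFun p (1 + u) (k + 1) 0 = (1 + e k) * runsGenFun p (1 + u) k 0`:
it turns the generating function of the 2-runs statistic into a product of factors close to `1`. -/
noncomputable def runsDefect (p : ℝ) (u : ℂ) : ℕ → ℂ
  | 0 => 0
  | k + 1 => p ^ 2 * u + p * (1 - p) * u * (runsDefect p u k / (1 + runsDefect p u k))

section Defect

variable {p : ℝ} {u : ℂ} (hp0 : 0 ≤ p) (hp1 : p ≤ 1) (hu : p * ‖u‖ ≤ 1 / 4)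
include hp0 hp1

theorem norm_mul_one_sub_mul_le : ‖(p : ℂ) * (1 - p) * u‖ ≤ p * ‖u‖ := by
  rw [norm_mul, norm_mul, ← Complex.ofReal_one, ← Complex.ofReal_sub, Complex.norm_real,
    Complex.norm_real, Real.norm_of_nonneg hp0, Real.norm_of_nonneg (sub_nonneg.2 hp1)]
  gcongr
  exact mul_le_of_le_one_right hp0 (by linarith)

include hu

theorem norm_runsDefect_le (k : ℕ) : ‖runsDefect p u k‖ ≤ 2 * p ^ 2 * ‖u‖ := by
  induction k with
  | zero =>
    rw [runsDefect, norm_zero]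
    positivity
  | succ k ih =>
    have hhalf : ‖runsDefect p u k‖ ≤ 1 / 2 := by nlinarith
    have hquot := norm_div_one_add_le hhalf
    rw [runsDefect]
    refine (norm_add_le _ _).trans ?_
    rw [norm_mul, norm_pow, Complex.norm_real, Real.norm_of_nonneg hp0, norm_mul]
    have hsmall := (norm_mul_one_sub_mul_le (u := u) hp0 hp1).trans hu
    nlinarith [norm_nonneg (runsDefect p u k / (1 + runsDefect p u k))]

theorem norm_runsDefect_le_one_half (k : ℕ) : ‖runsDefect p u k‖ ≤ 1 / 2 := by
  nlinarith [norm_runsDefect_le hp0 hp1 hu k]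

theorem norm_runsDefect_succ_sub_le (k : ℕ) :
    ‖runsDefect p u (k + 1) - p ^ 2 * u‖ ≤ 4 * p ^ 3 * ‖u‖ ^ 2 := by
  have hquot := norm_div_one_add_le (norm_runsDefect_le_one_half hp0 hp1 hu k)
  have hdefect := norm_runsDefect_le hp0 hp1 hu k
  rw [runsDefect, add_sub_cancel_left, norm_mul]
  calc _ ≤ p * ‖u‖ * (2 * (2 * p ^ 2 * ‖u‖)) :=
        mul_le_mul (norm_mul_one_sub_mul_le hp0 hp1) (by linarith) (norm_nonneg _) (by positivity)
    _ = _ := by ring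

theorem norm_runsDefect_add_two_sub_le (k : ℕ) :
    ‖runsDefect p u (k + 2) - (p ^ 2 * u + p ^ 3 * (1 - p) * u ^ 2)‖ ≤
      12 * p ^ 4 * ‖u‖ ^ 3 := by
  set e := runsDefect p u (k + 1) with he
  have hquot := norm_div_one_add_sub_self_le (norm_runsDefect_le_one_half hp0 hp1 hu (k + 1))
  have hdefect := norm_runsDefect_le hp0 hp1 hu (k + 1)
  have hlinear := norm_runsDefect_succ_sub_le hp0 hp1 hu k
  rw [← he] at hquot hdefect hlinear
  have hsplit : runsDefect p u (k + 2) - (p ^ 2 * u + p ^ 3 * (1 - p) * u ^ 2) =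
      p * (1 - p) * u * ((e / (1 + e) - e) + (e - p ^ 2 * u)) := by
    rw [runsDefect, ← he]
    ring
  have hp4 : p ^ 4 ≤ p ^ 3 := pow_le_pow_of_le_one hp0 hp1 (by norm_num)
  rw [hsplit, norm_mul]
  calc _ ≤ p * ‖u‖ * (2 * (2 * p ^ 2 * ‖u‖) ^ 2 + 4 * p ^ 3 * ‖u‖ ^ 2) := by
        refine mul_le_mul (norm_mul_one_sub_mul_le hp0 hp1) (norm_add_le_of_le ?_ hlinear)
          (norm_nonneg _) (by positivity)
        exact hquot.trans (by gcongr)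
    _ = (8 * p ^ 4 + 4 * p ^ 3) * (p * ‖u‖ ^ 3) := by ring
    _ ≤ 12 * p ^ 3 * (p * ‖u‖ ^ 3) := by
        gcongr
        linarith
    _ = _ := by ring

theorem norm_log_one_add_runsDefect_one_sub_le :
    ‖Complex.log (1 + runsDefect p u 1) - (p ^ 2 * u - p ^ 4 / 2 * u ^ 2)‖ ≤
      26 * p ^ 4 * ‖u‖ ^ 3 := by
  have hlog := norm_log_one_add_sub_quadratic_le (norm_runsDefect_le_one_half hp0 hp1 hu 1)
  have hone : runsDefect p u 1 = p ^ 2 * u := by simp [runsDefect]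
  have hp6 : p ^ 6 ≤ p ^ 4 := pow_le_pow_of_le_one hp0 hp1 (by norm_num)
  rw [hone] at hlog ⊢
  rw [show (p : ℂ) ^ 4 / 2 * u ^ 2 = (p ^ 2 * u) ^ 2 / 2 by ring]
  calc _ ≤ ‖(p : ℂ) ^ 2 * u‖ ^ 3 := hlog
    _ = p ^ 6 * ‖u‖ ^ 3 := by
      rw [norm_mul, norm_pow, Complex.norm_real, Real.norm_of_nonneg hp0]
      ring
    _ ≤ p ^ 4 * ‖u‖ ^ 3 := by gcongr
    _ ≤ _ := by nlinarith [show 0 ≤ p ^ 4 * ‖u‖ ^ 3 by positivity]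

theorem norm_log_one_add_runsDefect_sub_le (k : ℕ) :
    ‖Complex.log (1 + runsDefect p u (k + 2)) -
      (p ^ 2 * u + (p ^ 3 * (1 - p) - p ^ 4 / 2) * u ^ 2)‖ ≤ 26 * p ^ 4 * ‖u‖ ^ 3 := by
  have hlog := norm_log_one_add_sub_quadratic_le (norm_runsDefect_le_one_half hp0 hp1 hu (k + 2))
  have hdefect := norm_runsDefect_le hp0 hp1 hu (k + 2)
  have hlinear := norm_runsDefect_succ_sub_le hp0 hp1 hu (k + 1)
  have hquadratic := norm_runsDefect_add_two_sub_le hp0 hp1 hu k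
  set e := runsDefect p u (k + 2)
  have hsq : ‖(e ^ 2 - (p ^ 2 * u) ^ 2) / 2‖ ≤ 6 * p ^ 5 * ‖u‖ ^ 3 := by
    have hp2u : ‖(p : ℂ) ^ 2 * u‖ = p ^ 2 * ‖u‖ := by
      rw [norm_mul, norm_pow, Complex.norm_real, Real.norm_of_nonneg hp0]
    rw [sq_sub_sq, norm_div, norm_mul, Complex.norm_ofNat, div_le_iff₀ two_pos]
    calc _ ≤ (2 * p ^ 2 * ‖u‖ + p ^ 2 * ‖u‖) * (4 * p ^ 3 * ‖u‖ ^ 2) :=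
          mul_le_mul (norm_add_le_of_le hdefect hp2u.le) hlinear (norm_nonneg _) (by positivity)
      _ = _ := by ring
  have hsplit : Complex.log (1 + e) - (p ^ 2 * u + (p ^ 3 * (1 - p) - p ^ 4 / 2) * u ^ 2) =
      (Complex.log (1 + e) - (e - e ^ 2 / 2)) +
        (e - (p ^ 2 * u + p ^ 3 * (1 - p) * u ^ 2)) - (e ^ 2 - (p ^ 2 * u) ^ 2) / 2 := by ring
  have hp5 : p ^ 5 ≤ p ^ 4 := pow_le_pow_of_le_one hp0 hp1 (by norm_num)
  have hp6 : p ^ 6 ≤ p ^ 4 := pow_le_pow_of_le_one hp0 hp1 (by norm_num)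
  rw [hsplit]
  calc _ ≤ (2 * p ^ 2 * ‖u‖) ^ 3 + 12 * p ^ 4 * ‖u‖ ^ 3 + 6 * p ^ 5 * ‖u‖ ^ 3 :=
        norm_sub_le_of_le (norm_add_le_of_le (hlog.trans (by gcongr)) hquadratic) hsq
    _ = (8 * p ^ 6 + 12 * p ^ 4 + 6 * p ^ 5) * ‖u‖ ^ 3 := by ring
    _ ≤ 26 * p ^ 4 * ‖u‖ ^ 3 := by
        gcongr
        linarith

theorem norm_sum_log_one_add_runsDefect_sub_le {n : ℕ} (hn : 1 ≤ n) :
    ‖∑ k ∈ Finset.range n, Complex.log (1 + runsDefect p u (k + 1)) -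
      (n * p ^ 2 * u + runsExcess n p / 2 * u ^ 2)‖ ≤ 26 * (n * p ^ 4 * ‖u‖ ^ 3) := by
  induction n, hn using Nat.le_induction with
  | base =>
    have hbase : ((1 : ℕ) * p ^ 2 * u + runsExcess 1 p / 2 * u ^ 2 : ℂ) =
        p ^ 2 * u - p ^ 4 / 2 * u ^ 2 := by
      rw [runsExcess]
      push_cast
      ring
    rw [Finset.sum_range_one, hbase]
    exact (norm_log_one_add_runsDefect_one_sub_le hp0 hp1 hu).trans_eq (by push_cast; ring)
  | succ n hn ih =>
    obtain ⟨k, rfl⟩ := Nat.exists_eq_add_of_le' hn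
    have hsplit : ((k + 1 + 1 : ℕ) * p ^ 2 * u + runsExcess (k + 1 + 1) p / 2 * u ^ 2 : ℂ) =
        ((k + 1 : ℕ) * p ^ 2 * u + runsExcess (k + 1) p / 2 * u ^ 2) +
          (p ^ 2 * u + (p ^ 3 * (1 - p) - p ^ 4 / 2) * u ^ 2) := by
      rw [runsExcess, runsExcess]
      push_cast
      ring
    rw [Finset.sum_range_succ, hsplit, add_sub_add_comm]
    refine (norm_add_le_of_le ih (norm_log_one_add_runsDefect_sub_le hp0 hp1 hu k)).trans_eq ?_
    push_cast
    ring

theorem runsGenFun_succ_eq_one_add_runsDefect_mul (k : ℕ) :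
    runsGenFun p (1 + u) (k + 1) 0 = (1 + runsDefect p u k) * runsGenFun p (1 + u) k 0 := by
  induction k with
  | zero => rw [runsGenFun_one, runsGenFun_zero, runsDefect, add_zero, one_mul]
  | succ k ih =>
    have hne := one_add_ne_zero_of_norm_le (norm_runsDefect_le_one_half hp0 hp1 hu k)
    rw [runsGenFun_add_two, ih, runsDefect]
    field_simp
    ring

theorem exists_runsGenFun_eq_exp {n : ℕ} (hn : 1 ≤ n) :
    ∃ L : ℂ, runsGenFun p (1 + u) (n + 1) 0 = Complex.exp L ∧
      ‖L - (n * p ^ 2 * u + runsExcess n p / 2 * u ^ 2)‖ ≤ 26 * (n * p ^ 4 * ‖u‖ ^ 3) := by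
  refine ⟨_, ?_, norm_sum_log_one_add_runsDefect_sub_le hp0 hp1 hu hn⟩
  clear hn
  induction n with
  | zero => simp [runsGenFun_one]
  | succ n ih =>
    have hne := one_add_ne_zero_of_norm_le (norm_runsDefect_le_one_half hp0 hp1 hu (n + 1))
    rw [runsGenFun_succ_eq_one_add_runsDefect_mul hp0 hp1 hu, ih, Finset.sum_range_succ,
      Complex.exp_add, Complex.exp_log hne, mul_comm]

end Defect

/-! ### Matching mean and variance -/

section Matching

variable {n : ℕ} {p : ℝ}

theorem runsExcess_le (hp0 : 0 ≤ p) (hp1 : p ≤ 1) : runsExcess n p ≤ 2 * (n * p ^ 3) := by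
  have hquartic : 0 ≤ n * p ^ 3 * (3 * p) := by positivity
  have hend : 0 ≤ 2 * p ^ 3 * (1 - p) := mul_nonneg (by positivity) (sub_nonneg.2 hp1)
  rw [runsExcess]
  linarith

variable (hn : 2 ≤ n) (hp0 : 0 < p) (hp1 : p < 1 / 2)
include hn hp0 hp1

theorem runsExcess_pos : 0 < runsExcess n p := by
  have hn2 : (2 : ℝ) ≤ n := by exact_mod_cast hn
  have hfactor : runsExcess n p = p ^ 3 * (n * (2 - 3 * p) - 2 * (1 - p)) := by
    rw [runsExcess]
    ring
  rw [hfactor]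
  exact mul_pos (pow_pos hp0 3) (by nlinarith)

theorem runsQbar_eq_div : runsQbar n p = n * p ^ 2 / (n * p ^ 2 + runsExcess n p) := by
  have := runsExcess_pos hn hp0 hp1
  have : 0 < n * p ^ 2 + runsExcess n p := by positivity
  rw [runsQbar, runsPbar]
  field_simp
  ring

theorem runsQbar_pos : 0 < runsQbar n p := by
  have := runsExcess_pos hn hp0 hp1
  have : 0 < n := by omega
  rw [runsQbar_eq_div hn hp0 hp1]
  positivity

theorem runsQbar_lt_one : runsQbar n p < 1 := by
  have := runsExcess_pos hn hp0 hp1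
  rw [runsQbar_eq_div hn hp0 hp1, div_lt_one (by positivity)]
  linarith

theorem runsR_pos : 0 < runsR n p := by
  have := runsExcess_pos hn hp0 hp1
  have : 0 < n := by omega
  rw [runsR]
  positivity

theorem one_sub_runsQbar_div_runsQbar :
    (1 - runsQbar n p) / runsQbar n p = runsExcess n p / (n * p ^ 2) := by
  have := runsExcess_pos hn hp0 hp1
  have : 0 < n := by omega
  rw [runsQbar_eq_div hn hp0 hp1]
  field_simp
  ring

theorem one_sub_runsQbar_div_runsQbar_le : (1 - runsQbar n p) / runsQbar n p ≤ 2 * p := by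
  have : 0 < n := by omega
  rw [one_sub_runsQbar_div_runsQbar hn hp0 hp1, div_le_iff₀ (by positivity)]
  linarith [runsExcess_le (n := n) hp0.le (by linarith)]

theorem runsR_mul_one_sub_runsQbar_div_runsQbar :
    runsR n p * ((1 - runsQbar n p) / runsQbar n p) = n * p ^ 2 := by
  have := runsExcess_pos hn hp0 hp1
  have : 0 < n := by omega
  rw [one_sub_runsQbar_div_runsQbar hn hp0 hp1, runsR]
  field_simp

theorem runsR_mul_one_sub_runsQbar_div_runsQbar_sq :
    runsR n p * ((1 - runsQbar n p) / runsQbar n p) ^ 2 = runsExcess n p := by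
  have := runsExcess_pos hn hp0 hp1
  have : 0 < n := by omega
  rw [one_sub_runsQbar_div_runsQbar hn hp0 hp1, runsR]
  field_simp

theorem runsR_mul_one_sub_runsQbar_div_runsQbar_cube_le :
    runsR n p * ((1 - runsQbar n p) / runsQbar n p) ^ 3 ≤ 4 * (n * p ^ 4) := by
  have hκ := one_sub_runsQbar_div_runsQbar_le hn hp0 hp1
  rw [pow_succ, ← mul_assoc, runsR_mul_one_sub_runsQbar_div_runsQbar_sq hn hp0 hp1]
  calc runsExcess n p * ((1 - runsQbar n p) / runsQbar n p)
      ≤ runsExcess n p * (2 * p) :=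
        mul_le_mul_of_nonneg_left hκ (runsExcess_pos hn hp0 hp1).le
    _ ≤ 2 * (n * p ^ 3) * (2 * p) := by
        gcongr
        exact runsExcess_le hp0.le (by linarith)
    _ = _ := by ring

/- The matching of mean and variance makes the exponents agree to second order. -/
theorem exists_runsGenFun_eq_negBinomialGenFun_mul_exp {u : ℂ} (hu : p * ‖u‖ ≤ 1 / 4) :
    ∃ D : ℂ, runsGenFun p (1 + u) (n + 1) 0 =
      negBinomialGenFun (runsR n p) (runsQbar n p) (1 + u) * Complex.exp D ∧
        ‖D‖ ≤ 30 * (n * p ^ 4 * ‖u‖ ^ 3) := by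
  obtain ⟨L, hL, hLe⟩ := exists_runsGenFun_eq_exp hp0.le (by linarith) hu (n := n) (by omega)
  obtain ⟨M, hM, hMe⟩ := exists_negBinomialGenFun_eq_exp (runsR_pos hn hp0 hp1).le
    (runsQbar_pos hn hp0 hp1) (runsQbar_lt_one hn hp0 hp1).le (u := u)
    (by nlinarith [one_sub_runsQbar_div_runsQbar_le hn hp0 hp1, norm_nonneg u])
  rw [runsR_mul_one_sub_runsQbar_div_runsQbar hn hp0 hp1,
    runsR_mul_one_sub_runsQbar_div_runsQbar_sq hn hp0 hp1] at hMe
  push_cast at hMe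
  refine ⟨L - M, by rw [hL, hM, ← Complex.exp_add, add_sub_cancel], ?_⟩
  rw [← sub_sub_sub_cancel_right L M (n * p ^ 2 * u + runsExcess n p / 2 * u ^ 2)]
  refine (norm_sub_le_of_le hLe hMe).trans ?_
  nlinarith [mul_le_mul_of_nonneg_right
    (runsR_mul_one_sub_runsQbar_div_runsQbar_cube_le hn hp0 hp1) (pow_nonneg (norm_nonneg u) 3)]

end Matching

/-! ### The local limit theorem -/

section Rate

variable {n : ℕ} {p : ℝ}

theorem exists_runsGenFun_circleMap_eq_mul_exp (hn : 2 ≤ n) (hp0 : 0 < p) (hp1 : p < 1 / 2)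
    {ρ θ : ℝ} (hρθ : p * (|ρ - 1| + |θ|) ≤ 1 / 4) :
    ∃ D : ℂ, runsGenFun p (circleMap 0 ρ θ) (n + 1) 0 =
      negBinomialGenFun (runsR n p) (runsQbar n p) (circleMap 0 ρ θ) * Complex.exp D ∧
        ‖D‖ ≤ 120 * (n * p ^ 4 * (|ρ - 1| ^ 3 + |θ| ^ 3)) := by
  have hu := norm_circleMap_zero_sub_one_le ρ θ
  obtain ⟨D, hD, hDle⟩ := exists_runsGenFun_eq_negBinomialGenFun_mul_exp hn hp0 hp1
    ((mul_le_mul_of_nonneg_left hu hp0.le).trans hρθ)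
  rw [add_sub_cancel] at hD
  refine ⟨D, hD, ?_⟩
  have hcube : ‖circleMap 0 ρ θ - 1‖ ^ 3 ≤ 4 * (|ρ - 1| ^ 3 + |θ| ^ 3) := by
    refine (pow_le_pow_left₀ (norm_nonneg _) hu 3).trans
      ((add_pow_le (abs_nonneg _) (abs_nonneg _) 3).trans_eq ?_)
    norm_num
  calc ‖D‖ ≤ 30 * (n * p ^ 4 * ‖circleMap 0 ρ θ - 1‖ ^ 3) := hDle
    _ ≤ 30 * (n * p ^ 4 * (4 * (|ρ - 1| ^ 3 + |θ| ^ 3))) := by gcongr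
    _ = _ := by ring

theorem le_runsR_of_le_mul (hn : 2 ≤ n) (hp0 : 0 < p) (hp1 : p < 1 / 2) {t C : ℝ}
    (hCp : 2 * C * p ≤ 1) (ht : t ≤ C * (n * p ^ 2)) : t ≤ runsR n p := by
  have hκ := one_sub_runsQbar_div_runsQbar_le hn hp0 hp1
  have hrκ := runsR_mul_one_sub_runsQbar_div_runsQbar hn hp0 hp1
  have hr := runsR_pos hn hp0 hp1
  rcases le_total C 0 with hC | hC
  · exact ht.trans ((mul_nonpos_of_nonpos_of_nonneg hC (by positivity)).trans hr.le)
  · calc t ≤ C * (n * p ^ 2) := ht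
      _ ≤ C * (runsR n p * (2 * p)) := by
        rw [← hrκ]
        gcongr
      _ = 2 * C * p * runsR n p := by ring
      _ ≤ runsR n p := mul_le_of_le_one_left hr.le hCp

theorem abs_negBinomialSaddle_runsR_sub_one_le (hn : 2 ≤ n) (hp0 : 0 < p) (hp1 : p < 1 / 2)
    (x : ℕ) : |negBinomialSaddle (runsR n p) (runsQbar n p) x - 1| ≤
      |x - n * p ^ 2| / (n * p ^ 2) := by
  rw [← runsR_mul_one_sub_runsQbar_div_runsQbar hn hp0 hp1]
  exact abs_negBinomialSaddle_sub_one_le (runsR_pos hn hp0 hp1) (runsQbar_pos hn hp0 hp1)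
    (runsQbar_lt_one hn hp0 hp1) x

theorem IsIIDBernoulli.abs_measureReal_twoRuns_sub_negBinomial_le {Ω : Type*} [MeasurableSpace Ω]
    {μ : Measure Ω} {η : Fin (n + 1) → Ω → ℕ} (h : IsIIDBernoulli μ η p) (hn : 2 ≤ n) (hp : 0 < p)
    {x : ℕ} {C : ℝ} (hCp : 1000 * C * p ≤ 1) (hx : x ≤ C * (n * p ^ 2))
    (hx' : n * p ^ 2 ≤ C * x) :
    |μ.real {ω | twoRuns η ω = x} - negBinomial (runsR n p) (runsQbar n p) x| ≤
      20 * Real.exp (120 * (|x - n * p ^ 2| ^ 3 / (n * p) ^ 2)) *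
        (120 * (|x - n * p ^ 2| ^ 3 / (n * p) ^ 2) + 72000 * C * p ^ 2) *
          negBinomial (runsR n p) (runsQbar n p) x := by
  have : 0 < n := by omega
  have hmean : 0 < n * p ^ 2 := by positivity
  have hx0 : x ≠ 0 := by
    rintro rfl
    exact hmean.not_ge (hx'.trans_eq (by simp))
  have hC : 1 ≤ C := by
    by_contra! hC
    nlinarith [hx.trans_lt (mul_lt_of_lt_one_left hmean hC)]
  have hp1 : p < 1 / 2 := by nlinarith
  set ρ := negBinomialSaddle (runsR n p) (runsQbar n p) x
  have hρ := abs_negBinomialSaddle_runsR_sub_one_le hn hp hp1 x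
  have hρC : |ρ - 1| ≤ C := by
    refine hρ.trans ((div_le_iff₀ hmean).2 (abs_le.2 ⟨?_, ?_⟩)) <;>
      nlinarith [x.cast_nonneg (α := ℝ)]
  refine (abs_sub_negBinomial_le (a := 120 * (|x - n * p ^ 2| ^ 3 / (n * p) ^ 2))
    (b := 480 * C * p ^ 2) (runsQbar_pos hn hp hp1) (runsQbar_lt_one hn hp hp1) hx0
    (le_runsR_of_le_mul hn hp hp1 (by nlinarith) hx) (fun z _ => h.hasSum_measureReal_twoRuns z)
    (by positivity) (by positivity) (by nlinarith) fun θ hθ => ?_).trans_eq (by ring)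
  obtain ⟨D, hD, hDle⟩ := exists_runsGenFun_circleMap_eq_mul_exp hn hp hp1 (ρ := ρ) (θ := θ)
    (by nlinarith [Real.pi_lt_four])
  refine ⟨D, hD, hDle.trans ?_⟩
  have hθ3 : |θ| ^ 3 ≤ 4 * θ ^ 2 := by
    rw [pow_succ', sq_abs]
    nlinarith [Real.pi_lt_four, sq_nonneg θ]
  calc 120 * (n * p ^ 4 * (|ρ - 1| ^ 3 + |θ| ^ 3))
      ≤ 120 * (n * p ^ 4 * ((|x - n * p ^ 2| / (n * p ^ 2)) ^ 3 + 4 * θ ^ 2)) := by gcongr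
    _ = 120 * (|x - n * p ^ 2| ^ 3 / (n * p) ^ 2) + 480 * p ^ 2 * θ ^ 2 * (n * p ^ 2) := by
        field_simp
        ring
    _ ≤ 120 * (|x - n * p ^ 2| ^ 3 / (n * p) ^ 2) + 480 * p ^ 2 * θ ^ 2 * (C * x) := by gcongr
    _ = _ := by ring

end Rate

theorem tendsto_abs_pow_three_div_sq_of_isLittleO {ι : Type*} {l : Filter ι} {f a b : ι → ℝ}
    (ha : 0 ≤ᶠ[l] a) (hb : 0 ≤ᶠ[l] b)
    (hf : f =o[l] fun k => a k ^ (2 / 3 : ℝ) * b k ^ (2 / 3 : ℝ)) :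
    Tendsto (fun k => |f k| ^ 3 / (a k * b k) ^ 2) l (𝓝 0) := by
  have hlim := (hf.norm_left.tendsto_div_nhds_zero).pow 3
  rw [zero_pow three_ne_zero] at hlim
  refine hlim.congr' ?_
  filter_upwards [ha, hb] with k hak hbk
  have hcube {t : ℝ} (ht : 0 ≤ t) : (t ^ (2 / 3 : ℝ)) ^ 3 = t ^ 2 := by
    rw [← Real.rpow_natCast, ← Real.rpow_mul ht]
    norm_num
  rw [div_pow, mul_pow, hcube hak, hcube hbk, Real.norm_eq_abs, mul_pow]

theorem exists_forall_eventually_le_mul_of_isTheta {ι : Type*} {l : Filter ι} {f g : ι → ℝ}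
    (hf : 0 ≤ f) (hg : 0 ≤ g) (h : f =Θ[l] g) :
    ∃ C ≥ 1, (∀ᶠ k in l, f k ≤ C * g k) ∧ ∀ᶠ k in l, g k ≤ C * f k := by
  obtain ⟨A, hA⟩ := h.1.bound
  obtain ⟨B, hB⟩ := h.2.bound
  refine ⟨max 1 (max A B), le_max_left _ _, ?_, ?_⟩
  · filter_upwards [hA] with k hk
    rw [Real.norm_of_nonneg (hf k), Real.norm_of_nonneg (hg k)] at hk
    exact hk.trans (mul_le_mul_of_nonneg_right (by simp) (hg k))
  · filter_upwards [hB] with k hk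
    rw [Real.norm_of_nonneg (hf k), Real.norm_of_nonneg (hg k)] at hk
    exact hk.trans (mul_le_mul_of_nonneg_right (by simp) (hf k))

theorem two_le_of_mul_pow_two_le {n x : ℕ} {p C : ℝ} (hp : 0 < p) (hp1 : p ≤ 1) (hnp : 0 < n * p)
    (hCp : C * p < 1) (hx : x ≤ C * (n * p ^ 2)) (hx' : n * p ^ 2 ≤ C * x) : 2 ≤ n := by
  have hx0 : x ≠ 0 := by
    rintro rfl
    have : 0 < n * p * p := mul_pos hnp hp
    simp only [Nat.cast_zero, mul_zero] at hx'
    linarith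
  by_contra! hn
  obtain rfl : n = 1 := by
    have : n ≠ 0 := by rintro rfl; simp at hnp
    omega
  have : (1 : ℝ) ≤ x := by exact_mod_cast Nat.one_le_iff_ne_zero.2 hx0
  rw [Nat.cast_one, one_mul] at hx
  nlinarith [mul_lt_mul_of_pos_right hCp hp]

theorem isLittleO_and_isLittleO_of_isLittleO_min {ι : Type*} {l : Filter ι} {f a b : ι → ℝ}
    (ha : 0 ≤ᶠ[l] a) (hb : 0 ≤ᶠ[l] b) (hf : f =o[l] fun k => min (a k) (b k)) :
    f =o[l] a ∧ f =o[l] b := by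
  have hmin : ∀ᶠ k in l, 0 ≤ min (a k) (b k) := (ha.and hb).mono fun _ h => le_min h.1 h.2
  constructor <;> refine hf.trans_isBigO (.of_bound' (hmin.mono fun k hk => ?_))
  · exact abs_le_abs_of_nonneg hk (min_le_left _ _)
  · exact abs_le_abs_of_nonneg hk (min_le_right _ _)

theorem theorem3_general {ι : Type*} {l : Filter ι} {Ω : ι → Type*} [∀ k, MeasurableSpace (Ω k)]
    (μ : ∀ k, Measure (Ω k)) (n : ι → ℕ) (p : ι → ℝ) (η : ∀ k, Fin (n k + 1) → Ω k → ℕ)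
    (hη : ∀ k, IsIIDBernoulli (μ k) (η k) (p k)) (x : ι → ℕ) (hp : Tendsto p l (𝓝 0))
    (hnp : ∀ᶠ k in l, 0 < n k * p k)
    (hxΘ : (fun k => (x k : ℝ)) =Θ[l] fun k => n k * p k ^ 2)
    (hx : (fun k => (x k : ℝ) - n k * p k ^ 2) =o[l]
      fun k => (n k : ℝ) ^ (2 / 3 : ℝ) * p k ^ (2 / 3 : ℝ)) :
    Tendsto (fun k => (μ k).real {ω | twoRuns (η k) ω = x k} /
      negBinomial (runsR (n k) (p k)) (runsQbar (n k) (p k)) (x k)) l (𝓝 1) := by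
  have hp0 : ∀ᶠ k in l, 0 < p k := hnp.mono fun k hk => pos_of_mul_pos_right hk (n k).cast_nonneg
  obtain ⟨C, hC, hle, hge⟩ := exists_forall_eventually_le_mul_of_isTheta
    (fun k => (x k).cast_nonneg) (fun k => by positivity) hxΘ
  have : 0 < C := one_pos.trans_le hC
  have hτ := (tendsto_abs_pow_three_div_sq_of_isLittleO (.of_forall fun k => (n k).cast_nonneg)
    (hp0.mono fun _ => le_of_lt) hx).const_mul 120
  rw [mul_zero] at hτ
  have hbound := ((Real.continuous_exp.tendsto 0).comp hτ |>.const_mul 20).mul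
    (hτ.add ((hp.pow 2).const_mul (72000 * C)))
  simp only [ne_eq, OfNat.ofNat_ne_zero, not_false_eq_true, zero_pow, mul_zero, add_zero] at hbound
  refine tendsto_iff_norm_sub_tendsto_zero.2
    (squeeze_zero' (.of_forall fun _ => norm_nonneg _) ?_ hbound)
  have hCp : ∀ᶠ k in l, p k ≤ 1 / (1000 * C) := hp.eventually_le_const (by positivity)
  filter_upwards [hp0, hnp, hle, hge, hCp] with k hpk hnpk hxle hxge hsmall
  replace hsmall : 1000 * C * p k ≤ 1 := by rwa [le_div_iff₀' (by positivity)] at hsmall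
  have hp1 : p k < 1 / 2 := by nlinarith
  have hn : 2 ≤ n k :=
    two_le_of_mul_pow_two_le hpk (by linarith) hnpk (by nlinarith) hxle hxge
  have hpos : 0 < negBinomial (runsR (n k) (p k)) (runsQbar (n k) (p k)) (x k) :=
    negBinomial_pos (runsR_pos hn hpk hp1) (runsQbar_pos hn hpk hp1) (runsQbar_lt_one hn hpk hp1) _
  rw [div_sub_one hpos.ne', Real.norm_eq_abs, abs_div, abs_of_pos hpos, div_le_iff₀ hpos]
  exact (hη k).abs_measureReal_twoRuns_sub_negBinomial_le hn hpk hsmall hxle hxge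

theorem theorem3 {Ω : ℕ → Type*} [∀ n, MeasurableSpace (Ω n)]
    (μ : ∀ n, Measure (Ω n)) [∀ n, IsProbabilityMeasure (μ n)]
    (p : ℕ → ℝ) (η : ∀ n, Fin (n + 1) → Ω n → ℕ)
    (hη : ∀ n, IsIIDBernoulli (μ n) (η n) (p n))
    (x : ℕ → ℕ)
    (hp : Tendsto p atTop (𝓝 0))
    (hnp : Tendsto (fun n : ℕ => (n : ℝ) * p n) atTop atTop)
    (hx : (fun n : ℕ => (x n : ℝ) - n * p n ^ 2) =o[atTop]
      fun n : ℕ => min ((n : ℝ) * p n ^ 2) ((n : ℝ) ^ (2 / 3 : ℝ) * p n ^ (2 / 3 : ℝ))) :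
    Tendsto (fun n : ℕ => (μ n).real {ω | twoRuns (η n) ω = x n} /
      negBinomial (runsR n (p n)) (runsQbar n (p n)) (x n)) atTop (𝓝 1) := by
  have hnp0 := hnp.eventually_gt_atTop 0
  obtain ⟨hmean, hdev⟩ := isLittleO_and_isLittleO_of_isLittleO_min
    (.of_forall fun n => by positivity) (hnp0.mono fun n hn => by
      have := pos_of_mul_pos_right hn n.cast_nonneg
      positivity) hx
  exact theorem3_general μ (fun n => n) p η hη x hp hnp0 (IsEquivalent.isTheta hmean) hdev
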